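/- A $k$-ranking of a finite simple graph $G$ is a labelling $f : V(G) \to \{1,\dots,k\}$ such that every path between two distinct vertices with the same label passes through a vertex with a larger label. The rank number $\chi_r(G)$ is the smallest $k$ for which $G$ has a $k$-ranking. For an integer $n \ge 0$, the triangle grid of side $n$ is the graph whose vertices are the lattice points $(i,j)$ with integers $i,j\ge 0$ and $i+j\le n-1$ (so that its rows have $n, n-1, \dots, 1$ vertices), two vertices being adjacent if they agree in one coordinate and differ by exactly $1$ in the other. Let $\mathrm{tri}_n$ be its rank number. Then for every integer $n \ge 0$, $$\mathrm{tri}_n \;\ge\; \frac{5}{3}\left\lfloor \frac{n}{2}\right\rfloor - \frac{34}{9}.$$ -/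

import Mathlib

/-- `f` is a `k`-ranking of `G`: a labelling of the vertices by integers from `1` to `k` such that
every path between two distinct vertices with the same label passes through a vertex with a
larger label. -/
def IsRanking {V : Type*} (G : SimpleGraph V) (k : ℕ) (f : V → ℕ) : Prop :=
  (∀ v, 1 ≤ f v ∧ f v ≤ k) ∧
    ∀ u v : V, u ≠ v → f u = f v → ∀ p : G.Walk u v, p.IsPath → ∃ w ∈ p.support, f u < f w

/-- Every finite graph has a `k`-ranking for some `k`, so that the rank number below is
a genuine minimum. -/
theorem exists_isRanking {V : Type*} [Finite V] (G : SimpleGraph V) :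
    ∃ (k : ℕ) (f : V → ℕ), IsRanking G k f := by
  obtain ⟨n, ⟨e⟩⟩ := Finite.exists_equiv_fin V
  refine ⟨n, fun v => (e v : ℕ) + 1, fun v => ⟨Nat.succ_pos _, (e v).isLt⟩, ?_⟩
  intro u v huv h
  exact absurd (e.injective (Fin.ext (Nat.succ_injective h))) huv

/-- The rank number `χ_r(G)`: the smallest `k` for which `G` has a `k`-ranking. -/
noncomputable def rankNumber {V : Type*} (G : SimpleGraph V) : ℕ :=
  sInf {k : ℕ | ∃ f : V → ℕ, IsRanking G k f}

/-- The vertices of the triangle grid of side `n`: the points `(i, j)` of the integer lattice with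
`i, j ≥ 0` and `i + j ≤ n - 1`. They form rows of `n, n - 1, …, 1` vertices. -/
abbrev TriangleVertex (n : ℕ) : Type := {p : ℕ × ℕ // p.1 + p.2 < n}

instance triangleVertexFinite (n : ℕ) : Finite (TriangleVertex n) :=
  Set.Finite.to_subtype <| (Set.finite_Iic ((n, n) : ℕ × ℕ)).subset fun p hp =>
    Prod.mk_le_mk.2 ⟨by have : p.1 + p.2 < n := hp; omega, by have : p.1 + p.2 < n := hp; omega⟩

/-- The triangle grid of side `n`: the subgraph of the square lattice induced on
`TriangleVertex n`; two vertices are adjacent when they agree in one coordinate and differ by `1`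
in the other. -/
def triangleGrid (n : ℕ) : SimpleGraph (TriangleVertex n) where
  Adj p q :=
    (p.1.1 = q.1.1 ∧ (p.1.2 + 1 = q.1.2 ∨ q.1.2 + 1 = p.1.2)) ∨
      (p.1.2 = q.1.2 ∧ (p.1.1 + 1 = q.1.1 ∨ q.1.1 + 1 = p.1.1))
  symm := ⟨fun p q h => by omega⟩
  loopless := ⟨fun p h => by omega⟩

/-! The stronger bound `n ≤ rankNumber (triangleGrid n)` holds, and 5/3 · ⌊n/2⌋ ≤ 5n/6 ≤ n. To prove
it, delete a vertex of largest label from a component, again and again: that label is unique there,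
so each deletion lowers the label bound `K` by at least one. `IsRanking.le_of_row_disjoint` follows
the component of a row free of deleted points in a corner triangle at `(a, b)`. Moving the corner
past a deleted point is paid for by the drop in the count, so `a + b + cornerCount a b R + K` never
grows. -/

/-- Two vertices are linked within `U` if some walk between them stays in `U`. -/
def LinkedWithin {V : Type*} (G : SimpleGraph V) (U : Set V) (u w : V) : Prop :=
  ∃ p : G.Walk u w, ∀ z ∈ p.support, z ∈ U

namespace LinkedWithin

variable {V : Type*} {G : SimpleGraph V} {U U' : Set V} {u v w : V}

theorem refl (h : u ∈ U) : LinkedWithin G U u u :=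
  ⟨.nil, by simpa using h⟩

theorem symm (h : LinkedWithin G U u v) : LinkedWithin G U v u := by
  obtain ⟨p, hp⟩ := h
  exact ⟨p.reverse, by simpa using hp⟩

theorem trans (h : LinkedWithin G U u v) (h' : LinkedWithin G U v w) : LinkedWithin G U u w := by
  obtain ⟨p, hp⟩ := h
  obtain ⟨q, hq⟩ := h'
  refine ⟨p.append q, fun z hz => ?_⟩
  rw [SimpleGraph.Walk.mem_support_append_iff] at hz
  exact hz.elim (hp z) (hq z)

theorem mono (hU : U ⊆ U') (h : LinkedWithin G U u v) : LinkedWithin G U' u v := by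
  obtain ⟨p, hp⟩ := h
  exact ⟨p, fun z hz => hU (hp z hz)⟩

theorem of_adj (h : G.Adj u v) (hu : u ∈ U) (hv : v ∈ U) : LinkedWithin G U u v :=
  ⟨.cons h .nil, by simp [hu, hv]⟩

theorem left_mem (h : LinkedWithin G U u v) : u ∈ U := by
  obtain ⟨p, hp⟩ := h
  exact hp u p.start_mem_support

theorem right_mem (h : LinkedWithin G U u v) : v ∈ U :=
  h.symm.left_mem

theorem of_mem_support (p : G.Walk u v) (hp : ∀ z ∈ p.support, z ∈ U) (hw : w ∈ p.support) :
    LinkedWithin G U u w := by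
  classical
  exact ⟨p.takeUntil w hw, fun z hz => hp z (p.support_takeUntil_subset_support hw hz)⟩

end LinkedWithin

/-- In a set of vertices linked within `U` to a common vertex, the largest label of a ranking
occurs only once. -/
theorem IsRanking.eq_of_linkedWithin {V : Type*} {G : SimpleGraph V} {k : ℕ} {f : V → ℕ}
    (hf : IsRanking G k f) {U : Set V} {e v w : V} (hv : LinkedWithin G U e v)
    (hmax : ∀ z, LinkedWithin G U e z → f z ≤ f v) (hw : LinkedWithin G U e w)
    (h : f w = f v) : w = v := by
  classical
  by_contra hne
  obtain ⟨p, hp⟩ := hv.symm.trans hw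
  obtain ⟨z, hz, hlt⟩ := hf.2 v w (Ne.symm hne) h.symm p.bypass p.bypass_isPath
  have := hmax z (hv.trans (.of_mem_support p hp (p.support_bypass_subset_support hz)))
  omega

section TriangleGrid

variable {n : ℕ}

/-- The corner triangle of the points `(i, j)` with `a ≤ i` and `b ≤ j`, without the points
of `R`. -/
def cornerTriangle (n a b : ℕ) (R : Finset (TriangleVertex n)) : Set (TriangleVertex n) :=
  {p | a ≤ p.1.1 ∧ b ≤ p.1.2 ∧ p ∉ R}

/-- The number of points of `R` with `a ≤ i` and `b ≤ j`. -/
def cornerCount (a b : ℕ) (R : Finset (TriangleVertex n)) : ℕ :=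
  (R.filter fun p => a ≤ p.1.1 ∧ b ≤ p.1.2).card

theorem cornerCount_insert_le (a b : ℕ) (R : Finset (TriangleVertex n)) (v : TriangleVertex n) :
    cornerCount a b (insert v R) ≤ cornerCount a b R + 1 := by
  unfold cornerCount
  rw [Finset.filter_insert]
  split_ifs
  · exact Finset.card_insert_le _ _
  · omega

theorem cornerCount_lt {a b a' b' : ℕ} {R : Finset (TriangleVertex n)} {p : TriangleVertex n}
    (hp : p ∈ R) (ha : a ≤ a') (hb : b ≤ b') (h : a ≤ p.1.1 ∧ b ≤ p.1.2)
    (h' : ¬(a' ≤ p.1.1 ∧ b' ≤ p.1.2)) : cornerCount a' b' R < cornerCount a b R := by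
  refine Finset.card_lt_card (Finset.ssubset_iff_subset_ne.2 ⟨fun q hq => ?_, fun heq => ?_⟩)
  · simp only [Finset.mem_filter] at hq ⊢
    exact ⟨hq.1, ha.trans hq.2.1, hb.trans hq.2.2⟩
  · have : p ∈ R.filter fun p => a ≤ p.1.1 ∧ b ≤ p.1.2 := Finset.mem_filter.2 ⟨hp, h⟩
    rw [← heq] at this
    exact h' (Finset.mem_filter.1 this).2

/-- A set of fewer points than rows misses some row, and every row below that one costs a
point. -/
theorem exists_row_disjoint (a : ℕ) (R : Finset (TriangleVertex n)) (b : ℕ)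
    (h : a + b + cornerCount a b R < n) :
    ∃ b', b ≤ b' ∧ a + b' < n ∧ cornerCount a b' R + b' ≤ cornerCount a b R + b ∧
      ∀ p ∈ R, a ≤ p.1.1 → p.1.2 ≠ b' := by
  by_cases hrow : ∀ p ∈ R, a ≤ p.1.1 → p.1.2 ≠ b
  · exact ⟨b, le_rfl, by omega, le_rfl, hrow⟩
  · push Not at hrow
    obtain ⟨p, hp, hpa, hpb⟩ := hrow
    have hlt : cornerCount a (b + 1) R < cornerCount a b R :=
      cornerCount_lt hp le_rfl (by omega) ⟨hpa, hpb.ge⟩ (by omega)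
    obtain ⟨b', h1, h2, h3, h4⟩ := exists_row_disjoint a R (b + 1) (by omega)
    exact ⟨b', by omega, h2, by omega, h4⟩
termination_by n - b

theorem linkedWithin_row {U : Set (TriangleVertex n)} {i j : ℕ} (d : ℕ) (h : i + d + j < n)
    (hU : ∀ p : TriangleVertex n, i ≤ p.1.1 → p.1.2 = j → p ∈ U) :
    LinkedWithin (triangleGrid n) U ⟨(i, j), by simp; omega⟩ ⟨(i + d, j), h⟩ := by
  induction d with
  | zero => exact .refl (hU _ le_rfl rfl)
  | succ d ih =>
    refine (ih (by omega)).trans (.of_adj (.inr ⟨rfl, .inl rfl⟩) ?_ ?_)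
    · exact hU _ (by simp) rfl
    · exact hU _ (by simp) rfl

theorem linkedWithin_column {U : Set (TriangleVertex n)} {i j : ℕ} (d : ℕ) (h : i + (j + d) < n)
    (hU : ∀ p : TriangleVertex n, j ≤ p.1.2 → p.1.1 = i → p ∈ U) :
    LinkedWithin (triangleGrid n) U ⟨(i, j), by simp; omega⟩ ⟨(i, j + d), h⟩ := by
  induction d with
  | zero => exact .refl (hU _ le_rfl rfl)
  | succ d ih =>
    refine (ih (by omega)).trans (.of_adj (.inl ⟨rfl, .inl rfl⟩) ?_ ?_)
    · exact hU _ (by simp) rfl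
    · exact hU _ (by simp) rfl

/-- The last point of row `b`. -/
def rowEnd (b : ℕ) (h : b < n) : TriangleVertex n := ⟨(n - 1 - b, b), by simp; omega⟩

theorem linkedWithin_rowEnd {U : Set (TriangleVertex n)} {i j : ℕ} (h : i + j < n)
    (hU : ∀ p : TriangleVertex n, i ≤ p.1.1 → p.1.2 = j → p ∈ U) :
    LinkedWithin (triangleGrid n) U ⟨(i, j), h⟩ (rowEnd j (by omega)) := by
  have := linkedWithin_row (n - 1 - j - i) (by omega) hU
  convert this using 3
  · simp only [rowEnd]
    omega
  · rfl

/-- If `R` misses row `b` of the corner triangle at `(a, b)`, then the labels of a ranking on the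
component of that row, after the removal of `R`, go up at least to the side of the corner triangle
minus the number of removed points. -/
theorem IsRanking.le_of_row_disjoint {k : ℕ} {f : TriangleVertex n → ℕ}
    (hf : IsRanking (triangleGrid n) k f) (a b K : ℕ) (R : Finset (TriangleVertex n))
    (hab : a + b < n) (hrow : ∀ p ∈ R, a ≤ p.1.1 → p.1.2 ≠ b)
    (hK : ∀ w, LinkedWithin (triangleGrid n) (cornerTriangle n a b R) (rowEnd b (by omega)) w →
      f w ≤ K) :
    n ≤ a + b + cornerCount a b R + K := by
  have hrowU : ∀ i, a ≤ i → ∀ p : TriangleVertex n, i ≤ p.1.1 → p.1.2 = b →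
      p ∈ cornerTriangle n a b R :=
    fun i hi p hp hpb => ⟨hi.trans hp, hpb.ge, fun hR => hrow p hR (hi.trans hp) hpb⟩
  have hend := linkedWithin_rowEnd hab (hrowU a le_rfl)
  have hend' := LinkedWithin.refl (G := triangleGrid n) hend.right_mem
  have hKpos : 1 ≤ K := (hf.1 _).1.trans (hK _ hend')
  -- Otherwise at least two units of room remain, so a free row survives one further deletion.
  by_cases hsmall : n ≤ a + b + cornerCount a b R + 1
  · omega
  -- A blocked first column is dropped: `a` grows by one and the count falls by at least one. The
  -- base point `rowEnd b` does not depend on `a`, so the component only shrinks.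
  by_cases hcol : ∃ p ∈ R, b ≤ p.1.2 ∧ p.1.1 = a
  · obtain ⟨p, hp, hpb, hpa⟩ := hcol
    have hlt : cornerCount (a + 1) b R < cornerCount a b R :=
      cornerCount_lt hp (by omega) le_rfl ⟨hpa.ge, hpb⟩ (by omega)
    have hsub : cornerTriangle n (a + 1) b R ⊆ cornerTriangle n a b R :=
      fun q hq => ⟨by have := hq.1; omega, hq.2⟩
    have hdec : (cornerTriangle n (a + 1) b R).ncard < (cornerTriangle n a b R).ncard := by
      refine Set.ncard_lt_ncard (hsub.ssubset_of_mem_notMem hend.left_mem fun h => ?_)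
        (Set.toFinite _)
      have := h.1
      simp at this
    have := hf.le_of_row_disjoint (a + 1) b K R (by omega)
      (fun q hq hqa => hrow q hq (by omega)) fun w hw => hK w (hw.mono hsub)
    omega
  · push Not at hcol
    obtain ⟨v, hv, hmax⟩ := Set.exists_max_image
      {w | LinkedWithin (triangleGrid n) (cornerTriangle n a b R) (rowEnd b (by omega)) w} f
      (Set.toFinite _) ⟨_, hend'⟩
    have hins := cornerCount_insert_le a b R v
    -- The free row `b'` must avoid `v` too, but the path to it need not: it runs in the component
    -- before `v` is deleted, along row `b`, up the free column `a`, then along row `b'`.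
    obtain ⟨b', hbb', hab', hcount, hrow'⟩ := exists_row_disjoint a (insert v R) b (by omega)
    have hsub : cornerTriangle n a b' (insert v R) ⊆ cornerTriangle n a b R :=
      fun q hq => ⟨hq.1, hbb'.trans hq.2.1, fun h => hq.2.2 (Finset.mem_insert_of_mem h)⟩
    have hdec : (cornerTriangle n a b' (insert v R)).ncard < (cornerTriangle n a b R).ncard :=
      Set.ncard_lt_ncard (hsub.ssubset_of_mem_notMem hv.right_mem
        fun h => h.2.2 (Finset.mem_insert_self _ _)) (Set.toFinite _)
    have hlink : LinkedWithin (triangleGrid n) (cornerTriangle n a b R) (rowEnd b (by omega))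
        (rowEnd b' (by omega)) := by
      obtain ⟨d, rfl⟩ := Nat.exists_eq_add_of_le hbb'
      refine hend.symm.trans ((linkedWithin_column d hab' ?_).trans (linkedWithin_rowEnd _ ?_))
      · exact fun p hpb hpa => ⟨hpa.ge, hpb, fun hR => hcol p hR hpb hpa⟩
      · exact fun p hpa hpb => ⟨hpa, by omega,
          fun hR => hrow' p (Finset.mem_insert_of_mem hR) hpa hpb⟩
    -- The new component lies in the old one without `v`, the only vertex there with label `f v ≤
    -- K`.
    have := hf.le_of_row_disjoint a b' (K - 1) (insert v R) hab' hrow' fun w hw => by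
      have hw' := hlink.trans (hw.mono hsub)
      have hne : w ≠ v := fun h => hw.right_mem.2.2 (h ▸ Finset.mem_insert_self _ _)
      have hlt : f w ≠ f v := fun h => hne (hf.eq_of_linkedWithin hv hmax hw' h)
      have h1 := hmax w hw'
      have h2 := hK v hv
      omega
    omega
termination_by (cornerTriangle n a b R).ncard

theorem le_rankNumber_triangleGrid (n : ℕ) : n ≤ rankNumber (triangleGrid n) := by
  obtain ⟨f, hf⟩ : ∃ f, IsRanking (triangleGrid n) (rankNumber (triangleGrid n)) f :=
    Nat.sInf_mem (exists_isRanking (triangleGrid n))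
  obtain rfl | hn := Nat.eq_zero_or_pos n
  · exact Nat.zero_le _
  · simpa [cornerCount] using
      hf.le_of_row_disjoint 0 0 _ ∅ hn (by simp) fun w _ => (hf.1 w).2

end TriangleGrid

theorem mainTheorem4 (n : ℕ) :
    (5 / 3 : ℝ) * ((n / 2 : ℕ) : ℝ) - 34 / 9 ≤ (rankNumber (triangleGrid n) : ℝ) := by
  have h1 : (n : ℝ) ≤ rankNumber (triangleGrid n) := by
    exact_mod_cast le_rankNumber_triangleGrid n
  have h2 : ((n / 2 : ℕ) : ℝ) ≤ n / 2 := by exact_mod_cast Nat.cast_div_le (m := n) (n := 2)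
  have h3 : (0 : ℝ) ≤ n := n.cast_nonneg
  linarith
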